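/- A semigroup $S$ is \emph{regular} if for every $s\in S$ there is $t\in S$ with $sts=s$; a regular semigroup $S$ is \emph{weakly generated} by $X\subseteq S$ if no proper subsemigroup of $S$ that is itself regular contains $X$. Let $A=\{1,x,x'\}$ with the involution $(x)'=x'$, $(x')'=x$, $1'=1$. Write a 5-tuple as $g=(g^l,g^{la},g^c,g^{ra},g^r)$. Put $g_{xx'}=(1,1,x,x',1)$, $G_{1,e}=\{g_{xx'}\}$, $G_{1,d}=G_{2,d}=\emptyset$, and for $i\ge 2$ $$G_{i,e}=\{(g,(g^{la})',g^l,(g^{ra})',g),\ (g,(g^{ra})',g^l,(g^{la})',g) : g\in G_{i-1,e}\}.$$ With $G_i=G_{i,e}\cup G_{i,d}$, let $G_{i,d}$, for $i\ge 3$, be the set of all $g\in G_{i-1}\times A\times G_{i-2}\times A\times G_{i-1}$ such that, writing $p=g^l$ and $q=g^r$, - $p\ne q$; - $(g^c,g^{la})=(p^l,(p^{la})')$ or $(g^c,g^{la})=(p^r,(p^{ra})')$; - $(g^c,g^{ra})=(q^l,(q^{la})')$ or $(g^c,g^{ra})=(q^r,(q^{ra})')$. Let $G^5=\bigcup_{i\ge1}G_i$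 and $G=A\cup G^5$. For $g\in G_i$ with $i\ge 2$ let $g^L$ and $g^R$ be the words $(g^{la})'\,g^l\,g^{la}$ and $(g^{ra})'\,g^r\,g^{ra}$. Let $\rho$ be the smallest congruence on the free semigroup $G^+$ that contains the pairs - $(xx'x,x)$, $(x'xx',x')$, $(g_{xx'},xx')$; - $(1y,y)$ and $(y1,y)$ for all $y\in G$; - $(g^2,g)$ for all $g\in G^5\cup\{1\}$; - $(g^cg^Lg,\,g)$, $(gg^Rg^c,\,g)$ and $(g^r g^{ra}\,g\,(g^{la})'g^l,\ g^r g^{ra}\,g^c\,(g^{la})'g^l)$ for all $g\in G_i$ with $i\ge2$. Write $[u]$ for the $\rho$-class of a word $u$. Let $F_1^1=G^+/\rho$, and let $F_1$ be its subsemigroup $F_1^1\setminus\{[1]\}$. **Proposition.** $F_1$ is a regular semigroup and it is weakly generated by $[x]$: the only regular subsemigroup of $F_1$ that contains $[x]$ is $F_1$ itself. -/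

import Mathlib

/-- A semigroup is regular if each element `s` satisfies `s * t * s = s` for some `t`. -/
def IsRegularSemigroup (S : Type*) [Semigroup S] : Prop :=
  ∀ s : S, ∃ t : S, s * t * s = s

/-- `S` has no proper regular subsemigroup containing `X`. -/
def IsWeaklyGeneratedBy (S : Type*) [Semigroup S] (X : Set S) : Prop :=
  ∀ T : Subsemigroup S, IsRegularSemigroup T → X ⊆ (T : Set S) → T = ⊤

namespace FreeRegular

/-- The anchors `1`, `x`, `x'`. -/
inductive Anchor : Type
  | one : Anchor
  | x : Anchor
  | xInv : Anchor

/-- The involution on anchors: it exchanges `x` and `x'` and fixes `1`. -/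
def Anchor.inv : Anchor → Anchor
  | .one => .one
  | .x => .xInv
  | .xInv => .x

/-- All nested 5-tuples `(l, la, c, ra, r)` over the anchors, including the anchors themselves.
The letters of the presentation are singled out by `IsGenerator` below. -/
inductive Letter : Type
  | anchor (a : Anchor) : Letter
  | tuple (l : Letter) (la : Anchor) (c : Letter) (ra : Anchor) (r : Letter) : Letter

namespace Letter

/-- The left entry of a 5-tuple (only used on 5-tuples). -/
def left : Letter → Letter
  | anchor a => anchor a
  | tuple l _ _ _ _ => l

/-- The left anchor of a 5-tuple (only used on 5-tuples). -/
def leftAnchor : Letter → Anchor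
  | anchor a => a
  | tuple _ la _ _ _ => la

/-- The right anchor of a 5-tuple (only used on 5-tuples). -/
def rightAnchor : Letter → Anchor
  | anchor a => a
  | tuple _ _ _ ra _ => ra

/-- The right entry of a 5-tuple (only used on 5-tuples). -/
def right : Letter → Letter
  | anchor a => anchor a
  | tuple _ _ _ _ r => r

end Letter

open Letter

/-- The 5-tuple `g_{xx'} = (1, 1, x, x', 1)`. -/
def gxx : Letter := tuple (anchor .one) .one (anchor .x) .xInv (anchor .one)

/-- The sets `G_{i,e}`, for `i ≥ 1` (with `∅` for the unused index `0`). -/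
def GE : ℕ → Set Letter
  | 0 => ∅
  | 1 => {gxx}
  | n + 2 => {t | ∃ g ∈ GE (n + 1),
      t = tuple g g.leftAnchor.inv g.left g.rightAnchor.inv g ∨
      t = tuple g g.rightAnchor.inv g.left g.leftAnchor.inv g}

/-- The sets `G_{i,d}`, for `i ≥ 1` (with `∅` for the unused index `0`). -/
def GD : ℕ → Set Letter
  | 0 => ∅
  | 1 => ∅
  | 2 => ∅
  | n + 3 => {t | ∃ l la c ra r, t = tuple l la c ra r ∧
      l ∈ GE (n + 2) ∪ GD (n + 2) ∧ c ∈ GE (n + 1) ∪ GD (n + 1) ∧ r ∈ GE (n + 2) ∪ GD (n + 2) ∧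
      l ≠ r ∧
      ((c, la) = (l.left, l.leftAnchor.inv) ∨ (c, la) = (l.right, l.rightAnchor.inv)) ∧
      ((c, ra) = (r.left, r.leftAnchor.inv) ∨ (c, ra) = (r.right, r.rightAnchor.inv))}

/-- `G_i = G_{i,e} ∪ G_{i,d}`: the 5-tuples of height `i`. -/
def GH (i : ℕ) : Set Letter := GE i ∪ GD i

/-- `G^5`: the union of all the sets `G_i`. -/
def G5 : Set Letter := ⋃ i, GH i

/-- The set `G` of generators consists of the anchors and the 5-tuples of `G^5`. -/
def IsGenerator (y : Letter) : Prop := (∃ a, y = anchor a) ∨ y ∈ G5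

/-- The type of generators. -/
abbrev Gen : Type := {y : Letter // IsGenerator y}

theorem gxx_mem : gxx ∈ G5 := Set.mem_iUnion.2 ⟨1, Or.inl rfl⟩

/-- The one-letter word given by an anchor. -/
def anch (a : Anchor) : FreeSemigroup Gen := FreeSemigroup.of ⟨anchor a, Or.inl ⟨a, rfl⟩⟩

/-- The one-letter word given by a generator. -/
abbrev letter (y : Gen) : FreeSemigroup Gen := FreeSemigroup.of y

/-- The one-letter word `g_{xx'}`. -/
def wgxx : FreeSemigroup Gen := letter ⟨gxx, Or.inr gxx_mem⟩

/-- The entries of a 5-tuple of height at least `2`: the left and right entries are 5-tuples of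
`G^5`, the middle entry is a 5-tuple of `G^5` or the letter `1`. -/
theorem entries_mem {i : ℕ} (hi : 2 ≤ i) {l c r : Letter} {la ra : Anchor}
    (h : tuple l la c ra r ∈ GH i) :
    l ∈ G5 ∧ r ∈ G5 ∧ (c = anchor .one ∨ c ∈ G5) := by
  have key : ∀ n l la c ra r, tuple l la c ra r ∈ GE (n + 1) → (l = anchor .one ∨ l ∈ G5) := by
    intro n l la c ra r h
    match n, h with
    | 0, h =>
      left
      simp only [GE, gxx, Set.mem_singleton_iff, tuple.injEq] at h
      exact h.1
    | n + 1, ⟨g, hg, h⟩ =>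
      right
      rcases h with h | h <;> (rw [tuple.injEq] at h; rw [h.1];
                               exact Set.mem_iUnion.2 ⟨n + 1, Or.inl hg⟩)
  obtain ⟨n, rfl⟩ : ∃ n, i = n + 2 := ⟨i - 2, by omega⟩
  rcases h with ⟨g, hg, h⟩ | h
  · have hg5 : g ∈ G5 := Set.mem_iUnion.2 ⟨n + 1, Or.inl hg⟩
    have hgl : g.left = anchor .one ∨ g.left ∈ G5 := by
      cases g with
      | anchor a =>
        exfalso
        cases n with
        | zero => simp [GE, gxx] at hg
        | succ n => obtain ⟨g, -, h | h⟩ := hg <;> cases h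
      | tuple l la c ra r => exact key n l la c ra r hg
    rcases h with h | h <;> (rw [tuple.injEq] at h; obtain ⟨rfl, -, rfl, -, rfl⟩ := h;
                             exact ⟨hg5, hg5, hgl⟩)
  · cases n with
    | zero => exact h.elim
    | succ n =>
      obtain ⟨l', la', c', ra', r', h, h1, h2, h3, -⟩ := h
      rw [tuple.injEq] at h
      obtain ⟨rfl, -, rfl, -, rfl⟩ := h
      exact ⟨Set.mem_iUnion.2 ⟨n + 2, h1⟩, Set.mem_iUnion.2 ⟨n + 2, h3⟩,
        Or.inr (Set.mem_iUnion.2 ⟨n + 1, h2⟩)⟩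

/-- The defining relations of the presentation. The first six constructors make `x'` an inverse of
`x` with `x x' = g_{xx'}`, make `1` an identity, and make `1` and the 5-tuples idempotents. In the
last three, `g = (l, la, c, ra, r)` is a 5-tuple of height at least `2`; the words `g^L` and `g^R`
are `(la)' l la` and `(ra)' r ra`. -/
inductive Rel : FreeSemigroup Gen → FreeSemigroup Gen → Prop
  | x_xInv_x : Rel (anch .x * anch .xInv * anch .x) (anch .x)
  | xInv_x_xInv : Rel (anch .xInv * anch .x * anch .xInv) (anch .xInv)
  | gxx_eq : Rel wgxx (anch .x * anch .xInv)
  | one_mul (y : Gen) : Rel (anch .one * letter y) (letter y)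
  | mul_one (y : Gen) : Rel (letter y * anch .one) (letter y)
  | idem (y : Gen) (hy : y.1 = anchor .one ∨ y.1 ∈ G5) : Rel (letter y * letter y) (letter y)
  | sandwich_left (g l c r : Gen) (la ra : Anchor) (i : ℕ) (hi : 2 ≤ i) (hg : g.1 ∈ GH i)
      (h : g.1 = tuple l.1 la c.1 ra r.1) :
      Rel (letter c * (anch la.inv * letter l * anch la) * letter g) (letter g)
  | sandwich_right (g l c r : Gen) (la ra : Anchor) (i : ℕ) (hi : 2 ≤ i) (hg : g.1 ∈ GH i)
      (h : g.1 = tuple l.1 la c.1 ra r.1) :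
      Rel (letter g * (anch ra.inv * letter r * anch ra) * letter c) (letter g)
  | sandwich_mid (g l c r : Gen) (la ra : Anchor) (i : ℕ) (hi : 2 ≤ i) (hg : g.1 ∈ GH i)
      (h : g.1 = tuple l.1 la c.1 ra r.1) :
      Rel (letter r * anch ra * letter g * anch la.inv * letter l)
        (letter r * anch ra * letter c * anch la.inv * letter l)

/-- `F_1^1`: the quotient of the free semigroup on `G` by the smallest congruence containing the
defining relations. -/
abbrev F11 : Type := (conGen Rel).Quotient

/-- The class `[u]` of a word. -/
def cls (u : FreeSemigroup Gen) : F11 := (u : (conGen Rel).Quotient)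

theorem cls_mul (u v : FreeSemigroup Gen) : cls (u * v) = cls u * cls v := rfl

theorem cls_eq_of_rel {u v : FreeSemigroup Gen} (h : Rel u v) : cls u = cls v :=
  (Con.eq _).2 (ConGen.Rel.of _ _ h)

open Classical in
/-- Multiplicative detection of the words all of whose letters are `1`. -/
noncomputable def oneDetector : FreeSemigroup Gen →ₙ* ℕ :=
  FreeSemigroup.lift (fun y : Gen => if y.1 = anchor .one then 1 else 0)

theorem ne_one_of_mem_G5 {y : Letter} (hy : y ∈ G5) (a : Anchor) : y ≠ anchor a := by
  rintro rfl
  obtain ⟨i, hi | hi⟩ := Set.mem_iUnion.1 hy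
  · match i, hi with
    | 1, hi => simp [GE, gxx] at hi
    | n + 2, ⟨g, _, h⟩ => rcases h with h | h <;> cases h
  · match i, hi with
    | n + 3, ⟨l, la, c, ra, r, h, _⟩ => cases h

theorem oneDetector_anch (a : Anchor) : oneDetector (anch a) = 1 ↔ a = .one := by
  cases a <;> simp [oneDetector, anch]

theorem oneDetector_anch_one : oneDetector (anch .one) = 1 := (oneDetector_anch _).2 rfl

theorem oneDetector_tuple (y : Gen) (hy : y.1 ∈ G5) : oneDetector (letter y) = 0 := by
  simp [oneDetector, ne_one_of_mem_G5 hy]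

theorem oneDetector_rel {u v : FreeSemigroup Gen} (h : Rel u v) :
    oneDetector u = oneDetector v := by
  have hx : oneDetector (anch .x) = 0 := by simp [oneDetector, anch]
  have hx' : oneDetector (anch .xInv) = 0 := by simp [oneDetector, anch]
  cases h with
  | x_xInv_x => simp [hx]
  | xInv_x_xInv => simp [hx']
  | gxx_eq => simp [hx, wgxx, oneDetector_tuple ⟨gxx, Or.inr gxx_mem⟩ gxx_mem]
  | one_mul y => simp [oneDetector_anch_one]
  | mul_one y => simp [oneDetector_anch_one]
  | idem y hy =>
    rcases hy with hy | hy
    · simp [oneDetector, hy]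
    · simp [oneDetector_tuple y hy]
  | sandwich_left g l c r la ra i hi hg h =>
    simp [oneDetector_tuple g (Set.mem_iUnion.2 ⟨i, hg⟩)]
  | sandwich_right g l c r la ra i hi hg h =>
    simp [oneDetector_tuple g (Set.mem_iUnion.2 ⟨i, hg⟩)]
  | sandwich_mid g l c r la ra i hi hg h =>
    rw [h] at hg
    simp [oneDetector_tuple l (entries_mem hi hg).1]

theorem cls_eq_one_iff (u : FreeSemigroup Gen) : cls u = cls (anch .one) ↔ oneDetector u = 1 := by
  constructor
  · intro h
    have h1 : conGen Rel ≤ Con.ker oneDetector :=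
      Con.conGen_le.2 fun a b hab => oneDetector_rel hab
    have h2 : oneDetector u = oneDetector (anch .one) := h1 ((Con.eq _).1 h)
    rw [h2, oneDetector_anch_one]
  · intro h
    induction u using FreeSemigroup.recOnMul with
    | ih1 y =>
      have hy : y.1 = anchor .one := by
        by_contra hy
        simp [oneDetector, hy] at h
      obtain ⟨y, hy'⟩ := y
      subst hy
      rfl
    | ih2 y v ih1 ih2 =>
      rw [map_mul] at h
      have h' := mul_eq_one.1 h
      rw [cls_mul, ih1 h'.1, ih2 h'.2, ← cls_mul]
      exact cls_eq_of_rel (Rel.one_mul _)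

/-- `F_1`: the subsemigroup of `F_1^1` of all elements other than `[1]`. -/
def F1 : Subsemigroup F11 where
  carrier := {a | a ≠ cls (anch .one)}
  mul_mem' := by
    intro a b ha _ hab
    obtain ⟨u, rfl⟩ := Quotient.exists_rep a
    obtain ⟨v, rfl⟩ := Quotient.exists_rep b
    have h : oneDetector (u * v) = 1 := (cls_eq_one_iff (u * v)).1 hab
    rw [map_mul] at h
    exact ha ((cls_eq_one_iff u).2 (mul_eq_one.1 h).1)

/-- The element `[x]` of `F_1`. -/
def xF1 : F1 :=
  ⟨cls (anch .x), fun h => by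
    have h1 := (oneDetector_anch .x).1 ((cls_eq_one_iff _).1 h)
    cases h1⟩

end FreeRegular

/-! View the letter `1` and the 5-tuples as vertices of a graph: each 5-tuple has a left and a right
edge down to its left and right entries, labelled by its anchors. The last sandwich relation says
that a valley, descending an edge `e` and then climbing a different edge `f` from the same lower
end, equals a peak over the new vertex `sand e f`. If `e = f`, the valley cancels (`valley_self`).
Removing valleys turns every word into a mountain, a path climbing from `1` followed by a path
descending to `1` (`exists_mt`).

Mountains are normal forms. Operators `actU e` and `actD e` on pairs of paths obey the same two
rules: descending after climbing the same edge is the identity, and any other valley becomes a peak.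
They yield operators for all letters satisfying the defining relations (`actW_rel`). A mountain acts
as `UU α * DD β`, and both its paths can be read off from the image of the empty pair, so the action
is faithful (`actF_injective`). Since `DD α * UU α = 1`, the reversed mountain is an inverse, which
gives regularity.

For weak generation, let `T` be regular and contain `1` and `[x]`. By induction on the 5-tuple `g`,
all mountains with summit `g` lie in `T` (`mt1_mem`). If `g = sand e f`, products of mountains with
summits `e.1` and `f.1` give those that climb to `g` by its right edge and leave by its left edge.
Such a mountain has an inverse in `T`, and counting lengths shows that the paths facing each other
in the products absorb each other (`absorbs_of_inverse`). Absorption forces equal top edges unless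
the first is a left edge and the second a right one (`Absorbs.of_append`). So the inverse also has
summit `g`, climbing left and descending right; lower mountains then adjust the rest of its paths.
The induction starts at `gxx`, where `[x]` is the left-right mountain. -/

namespace FreeRegular

open Letter

/-! ### Edges between letters -/

/-- An edge below a 5-tuple: the left one for `false`, the right one for `true`. -/
abbrev Edge : Type := Letter × Bool

/-- The lower end of an edge. -/
def bot : Edge → Letter
  | (g, false) => g.left
  | (g, true) => g.right

/-- The anchor read when an edge is climbed. -/
def lab : Edge → Anchor
  | (g, false) => g.leftAnchor
  | (g, true) => g.rightAnchor

/-- The 5-tuple whose right and left edges complete the valley going down `e` and up `f`. -/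
def sand (e f : Edge) : Letter := tuple f.1 (lab f).inv (bot f) (lab e).inv e.1

theorem anchor_inv_inv (a : Anchor) : a.inv.inv = a := by cases a <;> rfl

@[simp] theorem bot_sand_false (e f : Edge) : bot (sand e f, false) = f.1 := rfl
@[simp] theorem bot_sand_true (e f : Edge) : bot (sand e f, true) = e.1 := rfl
@[simp] theorem lab_sand_false (e f : Edge) : lab (sand e f, false) = (lab f).inv := rfl
@[simp] theorem lab_sand_true (e f : Edge) : lab (sand e f, true) = (lab e).inv := rfl

/-- The 5-tuples generated from `g_{xx'}` by completing valleys. -/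
inductive Tup : Letter → Prop
  | base : Tup gxx
  | step (e f : Edge) : Tup e.1 → Tup f.1 → e ≠ f → bot e = bot f → Tup (sand e f)

/-- The height of a letter. -/
def ht : Letter → ℕ
  | anchor _ => 0
  | tuple l _ _ _ _ => ht l + 1

theorem Tup.ht_bot {g : Letter} (hg : Tup g) : ∀ b, ht (bot (g, b)) + 1 = ht g := by
  induction hg with
  | base => intro b; cases b <;> rfl
  | step e f he hf hne hb ihe ihf =>
    intro b
    cases b
    · rfl
    · have h1 := ihe e.2
      have h2 := ihf f.2
      change ht e.1 + 1 = ht f.1 + 1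
      change ht (bot e) + 1 = _ at h1
      change ht (bot f) + 1 = _ at h2
      rw [← h1, ← h2, hb]

theorem Tup.ht_pos {g : Letter} (hg : Tup g) : 0 < ht g := by
  have := hg.ht_bot false
  omega

/-- A vertex: the letter `1` or a 5-tuple. -/
def Vert (v : Letter) : Prop := v = anchor .one ∨ Tup v

theorem Tup.vert_bot {g : Letter} (hg : Tup g) (b : Bool) : Vert (bot (g, b)) := by
  cases hg with
  | base => cases b <;> exact Or.inl rfl
  | step e f he hf hne hb => cases b <;> [exact Or.inr hf; exact Or.inr he]

theorem bot_vert {e : Edge} (h : Tup e.1) : Vert (bot e) := h.vert_bot e.2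

theorem ht_bot_add_one {e : Edge} (h : Tup e.1) : ht (bot e) + 1 = ht e.1 := h.ht_bot e.2

/-! ### The 5-tuples of `G^5` are those obtained by completing valleys. -/

theorem left_eq_right_of_mem_GE : ∀ {i : ℕ} {g : Letter}, g ∈ GE i → g.left = g.right
  | 1, g, h => by rw [show g = gxx from h]; rfl
  | n + 2, g, h => by obtain ⟨p, -, rfl | rfl⟩ := h <;> rfl

theorem left_ne_right_of_mem_GD : ∀ {i : ℕ} {g : Letter}, g ∈ GD i → g.left ≠ g.right
  | n + 3, g, h => by
    obtain ⟨l, la, c, ra, r, rfl, -, -, -, h, -⟩ := h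
    exact h

theorem tup_of_mem_GE : ∀ {i : ℕ} {g : Letter}, g ∈ GE i → Tup g
  | 1, g, h => by rw [show g = gxx from h]; exact Tup.base
  | n + 2, g, h => by
    obtain ⟨p, hp, h⟩ := h
    have hlr := left_eq_right_of_mem_GE hp
    have hT := tup_of_mem_GE hp
    rcases h with rfl | rfl
    · exact Tup.step (p, true) (p, false) hT hT (by simp) hlr.symm
    · have := Tup.step (p, false) (p, true) hT hT (by simp) hlr
      simpa [sand, bot, lab, hlr] using this

theorem tup_of_mem_GD : ∀ {i : ℕ} {g : Letter}, g ∈ GD i → Tup g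
  | n + 3, g, h => by
    obtain ⟨l, la, c, ra, r, rfl, hl, -, hr, hne, h1, h2⟩ := h
    have hlT : Tup l := hl.elim tup_of_mem_GE tup_of_mem_GD
    have hrT : Tup r := hr.elim tup_of_mem_GE tup_of_mem_GD
    obtain ⟨b, hc, rfl⟩ : ∃ b, c = bot (l, b) ∧ la = (lab (l, b)).inv := by
      rcases h1 with h1 | h1 <;> rw [Prod.mk.injEq] at h1
      exacts [⟨false, h1⟩, ⟨true, h1⟩]
    obtain ⟨b', hc', rfl⟩ : ∃ b, c = bot (r, b) ∧ ra = (lab (r, b)).inv := by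
      rcases h2 with h2 | h2 <;> rw [Prod.mk.injEq] at h2
      exacts [⟨false, h2⟩, ⟨true, h2⟩]
    have := Tup.step (r, b') (l, b) hrT hlT (fun h => hne (Prod.mk.inj h).1.symm)
      (hc'.symm.trans hc)
    rw [hc]
    exact this

theorem tup_of_mem_G5 {g : Letter} (h : g ∈ G5) : Tup g := by
  obtain ⟨i, h | h⟩ := Set.mem_iUnion.1 h
  exacts [tup_of_mem_GE h, tup_of_mem_GD h]

/-- Membership in `GD` also constrains the middle entry, two levels down, where induction on `sand e
f` supplies no hypothesis; so the statement carries the lower ends along. Several later inductions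
on `Tup` use the same device. -/
theorem Tup.mem_GH {g : Letter} (hg : Tup g) :
    g ∈ GH (ht g) ∧ ∀ b, Tup (bot (g, b)) → bot (g, b) ∈ GH (ht (bot (g, b))) := by
  induction hg with
  | base =>
    refine ⟨Or.inl rfl, fun b h => ?_⟩
    cases b <;> cases h
  | step e f he hf hne hb ihe ihf =>
    refine ⟨?_, fun b h => by cases b <;> [exact ihf.1; exact ihe.1]⟩
    have hhe := ht_bot_add_one he
    have hhf := ht_bot_add_one hf
    have hh : ht e.1 = ht f.1 := by rw [← hhe, ← hhf, hb]
    change _ ∈ GH (ht f.1 + 1)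
    obtain ⟨n, hn⟩ : ∃ n, ht f.1 = n + 1 := ⟨ht (bot f), hhf.symm⟩
    obtain ⟨p, b⟩ := e
    obtain ⟨q, b'⟩ := f
    simp only at *
    have hp := ihe.1
    have hq := ihf.1
    rw [hh, hn] at hp
    rw [hn] at hq ⊢
    -- A valley between the two edges of one 5-tuple gives an element of `GE`, a valley between
    -- different 5-tuples one of `GD`.
    by_cases hpq : p = q
    · subst hpq
      have hlr : p.left = p.right := by
        cases b <;> cases b'
        exacts [absurd rfl hne, hb, hb.symm, absurd rfl hne]
      have hE : p ∈ GE (n + 1) := hp.resolve_right fun h => left_ne_right_of_mem_GD h hlr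
      refine Or.inl ⟨p, hE, ?_⟩
      cases b <;> cases b'
      exacts [absurd rfl hne, Or.inr (by simp [sand, bot, lab, hlr]), Or.inl rfl,
        absurd rfl hne]
    · cases n with
      | zero =>
        have h1 : ∀ {y}, y ∈ GH 1 → y = gxx := fun h => h.elim id False.elim
        exact absurd ((h1 hp).trans (h1 hq).symm) hpq
      | succ n =>
        have hbt : Tup (bot (q, b')) := by
          refine (bot_vert (e := (q, b')) hf).resolve_left fun h => ?_
          rw [h, hn] at hhf
          simp [ht] at hhf
        have hc := ihf.2 b' hbt
        rw [show ht (bot (q, b')) = n + 1 by omega] at hc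
        refine Or.inr ⟨q, _, _, _, p, rfl, hq, hc, hp, fun h => hpq h.symm, ?_, ?_⟩
        · cases b' <;> [exact Or.inl rfl; exact Or.inr rfl]
        · rw [← hb]
          cases b <;> [exact Or.inl rfl; exact Or.inr rfl]

theorem Tup.mem_G5 {g : Letter} (hg : Tup g) : g ∈ G5 := Set.mem_iUnion.2 ⟨_, hg.mem_GH.1⟩

theorem Tup.vert {g : Letter} (hg : Tup g) : Vert g := Or.inr hg

theorem Vert.isGenerator {v : Letter} (h : Vert v) : IsGenerator v :=
  h.elim (fun h => Or.inl ⟨_, h⟩) fun h => Or.inr h.mem_G5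

/-- The two edges below a 5-tuple are told apart by their lower ends and labels. -/
theorem Tup.bot_lab_ne {g : Letter} (hg : Tup g) :
    ¬ (bot (g, false) = bot (g, true) ∧ lab (g, false) = lab (g, true)) := by
  induction hg with
  | base => rintro ⟨-, h⟩; cases h
  | step e f he hf hne hb ihe ihf =>
    rintro ⟨h1, h2⟩
    simp only [bot_sand_false, bot_sand_true, lab_sand_false, lab_sand_true] at h1 h2
    have h3 : lab f = lab e := by rw [← anchor_inv_inv (lab f), h2, anchor_inv_inv]
    obtain ⟨p, b⟩ := e
    obtain ⟨q, b'⟩ := f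
    simp only at h1
    subst h1
    cases b <;> cases b'
    exacts [hne rfl, ihe ⟨hb, h3.symm⟩, ihe ⟨hb.symm, h3⟩, hne rfl]

open Classical in
/-- The edge below `l` with lower end `c` and label `a`. -/
noncomputable def edgeOf (l c : Letter) (a : Anchor) : Edge :=
  (l, if bot (l, false) = c ∧ lab (l, false) = a then false else true)

theorem edgeOf_eq {e : Edge} (he : Tup e.1) : edgeOf e.1 (bot e) (lab e) = e := by
  obtain ⟨g, b⟩ := e
  cases b
  · simp [edgeOf]
  · simp only [edgeOf, if_neg he.bot_lab_ne]

/-! ### An action on mountains -/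

open Classical in
/-- Push the descent of the edge `e` through an ascending path: what remains of the path, and the
edge descended in the end, if any. -/
noncomputable def push : List Edge → Edge → List Edge × Option Edge
  | [], e => ([], some e)
  | f :: us, e =>
    if e = f then (us, none)
    else ((sand e f, true) :: (push us (sand e f, false)).1, (push us (sand e f, false)).2)

theorem push_cons_self (e : Edge) (us : List Edge) : push (e :: us) e = (us, none) := by
  simp [push]

theorem push_cons_of_ne {e f : Edge} (h : e ≠ f) (us : List Edge) :
    push (f :: us) e =
      ((sand e f, true) :: (push us (sand e f, false)).1, (push us (sand e f, false)).2) := by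
  simp [push, h]

/-- Transformations of pairs consisting of an ascending and a descending path. -/
abbrev Act : Type := Function.End (List Edge × List Edge)

/-- Prepend the ascent of an edge. -/
def actU (e : Edge) : Act := fun s => (e :: s.1, s.2)

/-- Prepend the descent of an edge. -/
noncomputable def actD (e : Edge) : Act :=
  fun s => ((push s.1 e).1, (push s.1 e).2.toList ++ s.2)

theorem actD_mul_actU_self (e : Edge) : actD e * actU e = 1 := by
  funext s
  change ((push (e :: s.1) e).1, (push (e :: s.1) e).2.toList ++ s.2) = s
  simp [push_cons_self]

theorem actD_mul_actU_of_ne {e f : Edge} (h : e ≠ f) :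
    actD e * actU f = actU (sand e f, true) * actD (sand e f, false) := by
  funext s
  change ((push (f :: s.1) e).1, (push (f :: s.1) e).2.toList ++ s.2) = _
  rw [push_cons_of_ne h]
  rfl

/-- The action of the anchors. -/
noncomputable def actA : Anchor → Act
  | .one => 1
  | .x => actU (gxx, false) * actD (gxx, true)
  | .xInv => actU (gxx, true) * actD (gxx, false)

open Classical in
/-- The action of a distinguished ascending path from `1` to a letter. -/
noncomputable def up : Letter → Act
  | anchor _ => 1
  | tuple l la c ra r =>
    -- Among the 5-tuples considered, the middle entry `x` singles out `gxx`; all others have a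
    -- vertex there.
    if c = anchor .x then actU (gxx, false)
    else up c * actU (edgeOf l c la.inv) * actU (tuple l la c ra r, false)

open Classical in
/-- The action of a distinguished descending path from a letter to `1`. -/
noncomputable def dn : Letter → Act
  | anchor _ => 1
  | tuple l la c ra r =>
    if c = anchor .x then actD (gxx, false)
    else actD (tuple l la c ra r, true) * actD (edgeOf r c ra.inv) * dn c

theorem up_gxx : up gxx = actU (gxx, false) := by simp [gxx, up]
theorem dn_gxx : dn gxx = actD (gxx, false) := by simp [gxx, dn]

theorem Vert.ne_x {v : Letter} (h : Vert v) : v ≠ anchor .x := by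
  rintro rfl
  rcases h with h | h <;> cases h

theorem up_sand {e f : Edge} (hf : Tup f.1) :
    up (sand e f) = up (bot f) * actU f * actU (sand e f, false) := by
  rw [sand, up, if_neg (bot_vert hf).ne_x, anchor_inv_inv, edgeOf_eq hf]

theorem dn_sand {e f : Edge} (he : Tup e.1) (hb : bot e = bot f) :
    dn (sand e f) = actD (sand e f, true) * actD e * dn (bot e) := by
  rw [sand, dn, if_neg (hb ▸ bot_vert he).ne_x, anchor_inv_inv, ← hb, edgeOf_eq he]

/-- The distinguished descent from `sand e f` uses its right edge and `e`, the ascent uses `f` and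
its left edge. The valley in between becomes the peak over `sand e f`, whose two edges cancel
against the outer ones. -/
theorem Tup.dn_mul_up {g : Letter} (hg : Tup g) :
    dn g * up g = 1 ∧ ∀ b, dn (bot (g, b)) * up (bot (g, b)) = 1 := by
  induction hg with
  | base =>
    refine ⟨by rw [up_gxx, dn_gxx, actD_mul_actU_self], fun b => ?_⟩
    cases b <;> exact mul_one 1
  | step e f he hf hne hb ihe ihf =>
    refine ⟨?_, fun b => by cases b <;> [exact ihf.1; exact ihe.1]⟩
    have h : dn (bot f) * up (bot f) = 1 := ihf.2 f.2
    calc dn (sand e f) * up (sand e f)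
        = actD (sand e f, true) * actD e * (dn (bot f) * up (bot f)) * actU f *
            actU (sand e f, false) := by rw [dn_sand he hb, up_sand hf, hb]; simp only [mul_assoc]
      _ = actD (sand e f, true) * (actD e * actU f) * actU (sand e f, false) := by
          rw [h]; simp only [mul_assoc, one_mul]
      _ = (actD (sand e f, true) * actU (sand e f, true)) *
            (actD (sand e f, false) * actU (sand e f, false)) := by
          rw [actD_mul_actU_of_ne hne]; simp only [mul_assoc]
      _ = 1 := by rw [actD_mul_actU_self, actD_mul_actU_self, one_mul]

theorem Vert.dn_mul_up {v : Letter} (h : Vert v) : dn v * up v = 1 := by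
  rcases h with rfl | h
  exacts [one_mul 1, h.dn_mul_up.1]

/-- This translates anchors into edges. The labels of `sand e f` are inverted labels of `f` and `e`,
so the induction hypothesis turns the anchor into a lower edge, which meets the distinguished path
in a valley that cancels or becomes a peak. -/
theorem Tup.dn_lab_up {g : Letter} (hg : Tup g) :
    ∀ b, dn (bot (g, b)) * actA (lab (g, b)) * up g = actU (g, b) ∧
      dn g * actA (lab (g, b)).inv * up (bot (g, b)) = actD (g, b) := by
  induction hg with
  | base =>
    intro b
    rw [up_gxx, dn_gxx]
    cases b
    · change 1 * 1 * actU _ = _ ∧ actD _ * 1 * 1 = _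
      simp only [one_mul, mul_one, and_self]
    · change 1 * (actU (gxx, true) * actD (gxx, false)) * actU _ = _ ∧
        actD _ * (actU (gxx, false) * actD (gxx, true)) * 1 = _
      constructor
      · rw [one_mul, mul_assoc, actD_mul_actU_self, mul_one]
      · rw [mul_one, ← mul_assoc, actD_mul_actU_self, one_mul]
  | step e f he hf hne hb ihe ihf =>
    obtain ⟨e1, e2⟩ : dn (bot e) * actA (lab e) * up e.1 = actU e ∧
      dn e.1 * actA (lab e).inv * up (bot e) = actD e := ihe e.2
    obtain ⟨f1, f2⟩ : dn (bot f) * actA (lab f) * up f.1 = actU f ∧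
      dn f.1 * actA (lab f).inv * up (bot f) = actD f := ihf f.2
    have hv := actD_mul_actU_of_ne hne
    intro b
    rw [up_sand hf, dn_sand he hb]
    cases b
    · rw [bot_sand_false, lab_sand_false, anchor_inv_inv, hb]
      constructor
      · calc _ = (dn f.1 * actA (lab f).inv * up (bot f)) * actU f * actU (sand e f, false) := by
              simp only [mul_assoc]
          _ = _ := by rw [f2, actD_mul_actU_self, one_mul]
      · calc _ = actD (sand e f, true) * (actD e * (dn (bot f) * actA (lab f) * up f.1)) := by
              simp only [mul_assoc]
          _ = _ := by rw [f1, hv, ← mul_assoc, actD_mul_actU_self, one_mul]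
    · rw [bot_sand_true, lab_sand_true, anchor_inv_inv]
      constructor
      · calc _ = (dn e.1 * actA (lab e).inv * up (bot e)) * actU f * actU (sand e f, false) := by
              rw [hb]; simp only [mul_assoc]
          _ = _ := by rw [e2, hv, mul_assoc, actD_mul_actU_self, mul_one]
      · calc _ = actD (sand e f, true) * (actD e * (dn (bot e) * actA (lab e) * up e.1)) := by
              simp only [mul_assoc]
          _ = _ := by rw [e1, actD_mul_actU_self, mul_one]

theorem dn_lab_up {e : Edge} (he : Tup e.1) :
    dn (bot e) * actA (lab e) * up e.1 = actU e := (he.dn_lab_up e.2).1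

theorem dn_lab_inv_up {e : Edge} (he : Tup e.1) :
    dn e.1 * actA (lab e).inv * up (bot e) = actD e := (he.dn_lab_up e.2).2

/-- The action of a letter. -/
noncomputable def actL : Letter → Act
  | anchor a => actA a
  | tuple l la c ra r => up (tuple l la c ra r) * dn (tuple l la c ra r)

theorem Vert.actL {v : Letter} (h : Vert v) : actL v = up v * dn v := by
  rcases h with rfl | h
  · exact (one_mul 1).symm
  · cases h <;> rfl

/-- The action of words. -/
noncomputable def actW : FreeSemigroup Gen →ₙ* Act := FreeSemigroup.lift fun y => actL y.1

@[simp] theorem actW_letter (y : Gen) : actW (letter y) = actL y.1 := rfl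
@[simp] theorem actW_anch (a : Anchor) : actW (anch a) = actA a := rfl

theorem actA_x_mul_xInv : actA .x * actA .xInv = actU (gxx, false) * actD (gxx, false) := by
  change actU _ * actD _ * (actU _ * actD _) = _
  rw [mul_assoc, ← mul_assoc (actD _), actD_mul_actU_self, one_mul]

theorem Tup.exists_sand {g l c r : Letter} {la ra : Anchor} {i : ℕ} (hi : 2 ≤ i)
    (hg : g ∈ GH i) (h : g = tuple l la c ra r) :
    ∃ e f : Edge, Tup e.1 ∧ Tup f.1 ∧ e ≠ f ∧ bot e = bot f ∧ g = sand e f ∧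
      l = f.1 ∧ la = (lab f).inv ∧ c = bot f ∧ ra = (lab e).inv ∧ r = e.1 := by
  have hT : Tup g := tup_of_mem_G5 (Set.mem_iUnion.2 ⟨i, hg⟩)
  cases hT with
  | base =>
    rw [gxx, tuple.injEq] at h
    rw [gxx, h.1] at hg
    have := (entries_mem hi hg).1
    rw [← h.1] at this
    exact absurd rfl (ne_one_of_mem_G5 this .one)
  | step e f he hf hne hb =>
    rw [sand, tuple.injEq] at h
    obtain ⟨rfl, rfl, rfl, rfl, rfl⟩ := h
    exact ⟨e, f, he, hf, hne, hb, rfl, rfl, rfl, rfl, rfl, rfl⟩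

/-- Writing vertices as `up v * dn v` leaves each anchor between a `dn` and an `up`, hence an edge
operator. The outer sandwich relations become the recursions `up_sand` and `dn_sand`; the middle one
becomes the valley rule. -/
theorem actW_rel {u v : FreeSemigroup Gen} (h : Rel u v) : actW u = actW v := by
  cases h with
  | x_xInv_x =>
    simp only [map_mul, actW_anch]
    rw [actA_x_mul_xInv]
    change _ * (actU _ * actD _) = actU _ * actD _
    rw [mul_assoc, ← mul_assoc (actD _), actD_mul_actU_self, one_mul]
  | xInv_x_xInv =>
    simp only [map_mul, actW_anch]
    rw [mul_assoc, actA_x_mul_xInv]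
    change (actU _ * actD _) * _ = actU _ * actD _
    rw [mul_assoc, ← mul_assoc (actD _), actD_mul_actU_self, one_mul]
  | gxx_eq =>
    rw [map_mul, actW_anch, actW_anch, actA_x_mul_xInv]
    change up gxx * dn gxx = _
    rw [up_gxx, dn_gxx]
  | one_mul y => rw [map_mul]; exact one_mul _
  | mul_one y => rw [map_mul]; exact mul_one _
  | idem y hy =>
    have hv : Vert y.1 := hy.imp id tup_of_mem_G5
    rw [map_mul, actW_letter, hv.actL, mul_assoc, ← mul_assoc (dn _), hv.dn_mul_up,
      one_mul]
  | sandwich_left g l c r la ra i hi hg h =>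
    obtain ⟨e, f, he, hf, hne, hb, hg, hl, rfl, hc, rfl, hr⟩ := Tup.exists_sand hi hg h
    have hgT : Tup (sand e f) := Tup.step e f he hf hne hb
    have h1 := dn_lab_up hf
    have h2 := dn_lab_up (e := (sand e f, false)) hgT
    rw [bot_sand_false, lab_sand_false] at h2
    simp only [map_mul, actW_letter, actW_anch, hg, hl, hc, anchor_inv_inv]
    rw [(bot_vert hf).actL, hf.vert.actL, hgT.vert.actL]
    calc _ = up (bot f) * (dn (bot f) * actA (lab f) * up f.1) *
          (dn f.1 * actA (lab f).inv * up (sand e f)) * dn (sand e f) := by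
          simp only [mul_assoc]
      _ = _ := by rw [h1, h2, up_sand hf]
  | sandwich_right g l c r la ra i hi hg h =>
    obtain ⟨e, f, he, hf, hne, hb, hg, hl, rfl, hc, rfl, hr⟩ := Tup.exists_sand hi hg h
    have hgT : Tup (sand e f) := Tup.step e f he hf hne hb
    have h1 := dn_lab_inv_up he
    have h2 := dn_lab_inv_up (e := (sand e f, true)) hgT
    rw [bot_sand_true, lab_sand_true, anchor_inv_inv] at h2
    simp only [map_mul, actW_letter, actW_anch, hg, hr, hc, anchor_inv_inv]
    rw [(bot_vert hf).actL, he.vert.actL, hgT.vert.actL, ← hb]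
    calc _ = up (sand e f) * ((dn (sand e f) * actA (lab e) * up e.1) *
          (dn e.1 * actA (lab e).inv * up (bot e)) * dn (bot e)) := by
          simp only [mul_assoc]
      _ = _ := by rw [h1, h2, dn_sand he hb]
  | sandwich_mid g l c r la ra i hi hg h =>
    obtain ⟨e, f, he, hf, hne, hb, hg, hl, rfl, hc, rfl, hr⟩ := Tup.exists_sand hi hg h
    have hgT : Tup (sand e f) := Tup.step e f he hf hne hb
    have h1 := dn_lab_inv_up he
    have h2 := dn_lab_up hf
    have h3 := dn_lab_up (e := (sand e f, true)) hgT
    have h4 := dn_lab_inv_up (e := (sand e f, false)) hgT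
    rw [bot_sand_true, lab_sand_true] at h3
    rw [bot_sand_false, lab_sand_false, anchor_inv_inv] at h4
    simp only [map_mul, actW_letter, actW_anch, hg, hr, hl, hc, anchor_inv_inv]
    rw [(bot_vert hf).actL, he.vert.actL, hf.vert.actL, hgT.vert.actL]
    calc _ = up e.1 * ((dn e.1 * actA (lab e).inv * up (sand e f)) *
          (dn (sand e f) * actA (lab f) * up f.1)) * dn f.1 := by
          simp only [mul_assoc]
      _ = up e.1 * ((dn e.1 * actA (lab e).inv * up (bot e)) *
          (dn (bot f) * actA (lab f) * up f.1)) * dn f.1 := by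
          rw [h1, h2, h3, h4, actD_mul_actU_of_ne hne]
      _ = _ := by rw [hb]; simp only [mul_assoc]

/-- The action of `F_1^1`. -/
noncomputable def actF : F11 →ₙ* Act where
  toFun := Quotient.lift (fun u => actW u) fun u v h => by
    have h1 : conGen Rel ≤ Con.ker actW := Con.conGen_le.2 fun a b hab => actW_rel hab
    exact h1 h
  map_mul' := by
    rintro ⟨u⟩ ⟨v⟩
    exact map_mul actW u v

/-! ### Mountains -/

instance : Monoid F11 where
  one := cls (anch .one)
  one_mul a := by
    obtain ⟨u, rfl⟩ := Quotient.exists_rep a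
    change cls (anch .one * u) = cls u
    induction u using FreeSemigroup.recOnMul with
    | ih1 y => exact cls_eq_of_rel (Rel.one_mul y)
    | ih2 y v ih1 ih2 => rw [← mul_assoc, cls_mul, ih1, ← cls_mul]
  mul_one a := by
    obtain ⟨u, rfl⟩ := Quotient.exists_rep a
    change cls (u * anch .one) = cls u
    induction u using FreeSemigroup.recOnMul with
    | ih1 y => exact cls_eq_of_rel (Rel.mul_one y)
    | ih2 y v ih1 ih2 => rw [mul_assoc, cls_mul, ih2, ← cls_mul]

open Classical in
/-- The class of a letter, with value `1` if it is not a generator. -/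
noncomputable def lt (y : Letter) : F11 := if h : IsGenerator y then cls (letter ⟨y, h⟩) else 1

/-- The class of an anchor. -/
def an (a : Anchor) : F11 := cls (anch a)

theorem lt_gen (y : Gen) : lt y.1 = cls (letter y) := dif_pos y.2

theorem lt_anchor (a : Anchor) : lt (anchor a) = an a := dif_pos _

@[simp] theorem an_one : an .one = 1 := rfl

theorem Vert.mul_self {v : Letter} (h : Vert v) : lt v * lt v = lt v := by
  have := lt_gen ⟨v, h.isGenerator⟩
  simp only at this
  rw [this, ← cls_mul]
  exact cls_eq_of_rel (Rel.idem _ (h.imp id Tup.mem_G5))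

@[simp] theorem lt_one : lt (anchor .one) = 1 := lt_anchor _

theorem lt_gxx : lt gxx = an .x * an .xInv := by
  rw [lt_gen ⟨gxx, Or.inr gxx_mem⟩]
  exact cls_eq_of_rel Rel.gxx_eq

theorem x_mul_xInv_mul_x : an .x * an .xInv * an .x = an .x := cls_eq_of_rel Rel.x_xInv_x

theorem xInv_mul_x_mul_xInv : an .xInv * an .x * an .xInv = an .xInv :=
  cls_eq_of_rel Rel.xInv_x_xInv

/-! ### The sandwich relations in terms of edges. -/

theorem two_le_ht_sand {e f : Edge} (hf : Tup f.1) : 2 ≤ ht (sand e f) := by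
  have h : ht (sand e f) = ht f.1 + 1 := rfl
  have := hf.ht_pos
  omega

theorem sandwich_left {e f : Edge} (he : Tup e.1) (hf : Tup f.1) (hne : e ≠ f)
    (hb : bot e = bot f) :
    lt (bot f) * (an (lab f) * lt f.1 * an (lab f).inv) * lt (sand e f) = lt (sand e f) := by
  have hg := Tup.step e f he hf hne hb
  have := cls_eq_of_rel (Rel.sandwich_left ⟨_, hg.vert.isGenerator⟩
    ⟨_, hf.vert.isGenerator⟩ ⟨_, (bot_vert hf).isGenerator⟩
    ⟨_, he.vert.isGenerator⟩ _ _ _ (two_le_ht_sand hf) hg.mem_GH.1 rfl)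
  simp only [cls_mul, ← lt_gen, anchor_inv_inv] at this
  exact this

theorem sandwich_right {e f : Edge} (he : Tup e.1) (hf : Tup f.1) (hne : e ≠ f)
    (hb : bot e = bot f) :
    lt (sand e f) * (an (lab e) * lt e.1 * an (lab e).inv) * lt (bot f) = lt (sand e f) := by
  have hg := Tup.step e f he hf hne hb
  have := cls_eq_of_rel (Rel.sandwich_right ⟨_, hg.vert.isGenerator⟩
    ⟨_, hf.vert.isGenerator⟩ ⟨_, (bot_vert hf).isGenerator⟩
    ⟨_, he.vert.isGenerator⟩ _ _ _ (two_le_ht_sand hf) hg.mem_GH.1 rfl)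
  simp only [cls_mul, ← lt_gen, anchor_inv_inv] at this
  exact this

theorem sandwich_mid {e f : Edge} (he : Tup e.1) (hf : Tup f.1) (hne : e ≠ f)
    (hb : bot e = bot f) :
    lt e.1 * an (lab e).inv * lt (sand e f) * an (lab f) * lt f.1 =
      lt e.1 * an (lab e).inv * lt (bot f) * an (lab f) * lt f.1 := by
  have hg := Tup.step e f he hf hne hb
  have := cls_eq_of_rel (Rel.sandwich_mid ⟨_, hg.vert.isGenerator⟩
    ⟨_, hf.vert.isGenerator⟩ ⟨_, (bot_vert hf).isGenerator⟩
    ⟨_, he.vert.isGenerator⟩ _ _ _ (two_le_ht_sand hf) hg.mem_GH.1 rfl)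
  simp only [cls_mul, ← lt_gen, anchor_inv_inv] at this
  exact this

theorem bot_mul_sand {e f : Edge} (he : Tup e.1) (hf : Tup f.1) (hne : e ≠ f)
    (hb : bot e = bot f) :
    lt (bot f) * lt (sand e f) = lt (sand e f) := by
  conv_lhs => rw [← sandwich_left he hf hne hb]
  simp only [← mul_assoc]
  rw [(bot_vert hf).mul_self]
  simpa only [← mul_assoc] using sandwich_left he hf hne hb

theorem sand_mul_bot {e f : Edge} (he : Tup e.1) (hf : Tup f.1) (hne : e ≠ f)
    (hb : bot e = bot f) :
    lt (sand e f) * lt (bot f) = lt (sand e f) := by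
  conv_lhs => rw [← sandwich_right he hf hne hb]
  rw [mul_assoc, (bot_vert hf).mul_self]
  exact sandwich_right he hf hne hb

/-- Descending and climbing the same edge. -/
theorem valley_self {e : Edge} (he : Tup e.1) :
    lt e.1 * an (lab e).inv * lt (bot e) * an (lab e) * lt e.1 = lt e.1 := by
  obtain ⟨g, b⟩ := e
  have hg : Tup g := he
  have hi := hg.vert.mul_self
  clear he
  change lt g * an (lab (g, b)).inv * lt (bot (g, b)) * an (lab (g, b)) * lt g = lt g
  cases hg with
  | base =>
    cases b
    · change lt gxx * 1 * lt (anchor .one) * 1 * lt gxx = _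
      simp only [lt_one, mul_one, hi]
    · change lt gxx * an .x * lt (anchor .one) * an .xInv * lt gxx = _
      rw [lt_one, mul_one, mul_assoc (lt gxx), ← lt_gxx, hi, hi]
  | step e f he hf hne hb =>
    cases b
    · rw [bot_sand_false, lab_sand_false, anchor_inv_inv]
      have h1 := sandwich_left he hf hne hb
      have h2 := sand_mul_bot he hf hne hb
      calc _ = lt (sand e f) * lt (bot f) * (an (lab f) * lt f.1 * an (lab f).inv) *
            lt (sand e f) := by rw [h2]; simp only [mul_assoc]
        _ = lt (sand e f) * (lt (bot f) * (an (lab f) * lt f.1 * an (lab f).inv) *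
            lt (sand e f)) := by simp only [mul_assoc]
        _ = _ := by rw [h1, hi]
    · rw [bot_sand_true, lab_sand_true, anchor_inv_inv]
      have h1 := sandwich_right he hf hne hb
      have h2 := bot_mul_sand he hf hne hb
      calc _ = lt (sand e f) * (an (lab e) * lt e.1 * an (lab e).inv) *
            (lt (bot f) * lt (sand e f)) := by rw [h2]; simp only [mul_assoc]
        _ = (lt (sand e f) * (an (lab e) * lt e.1 * an (lab e).inv) * lt (bot f)) *
            lt (sand e f) := by simp only [mul_assoc]
        _ = _ := by rw [h1, hi]

/-- `Up v α t` says that `α` is a path climbing from `v` to `t`. -/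
inductive Up : Letter → List Edge → Letter → Prop
  | nil (v : Letter) : Up v [] v
  | cons (e : Edge) {v : Letter} {α : List Edge} {t : Letter} (he : Tup e.1) (hb : bot e = v)
      (h : Up e.1 α t) : Up v (e :: α) t

/-- The class of the word read along an ascending path starting at `v`. -/
noncomputable def PU : Letter → List Edge → F11
  | v, [] => lt v
  | v, e :: α => lt v * an (lab e) * PU e.1 α

/-- The class of the word read along a path ascending from `v`, when it is descended. -/
noncomputable def PD : Letter → List Edge → F11
  | v, [] => lt v
  | v, e :: β => PD e.1 β * an (lab e).inv * lt v

theorem Up.vert {v t : Letter} {α : List Edge} (h : Up v α t) (hv : Vert v) : Vert t := by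
  induction h with
  | nil => exact hv
  | cons e he hb h ih => exact ih he.vert

theorem Up.length {v t : Letter} {α : List Edge} (h : Up v α t) : ht v + α.length = ht t := by
  induction h with
  | nil => rfl
  | cons e he hb h ih => rw [← ih, ← ht_bot_add_one he, hb, List.length_cons]; omega

theorem Up.append {v t : Letter} {α : List Edge} (h : Up v α t) {e : Edge} (he : Tup e.1)
    (hb : bot e = t) : Up v (α ++ [e]) e.1 := by
  induction h with
  | nil => exact Up.cons e he hb (Up.nil _)
  | cons f hf hb' h ih => exact Up.cons f hf hb' (ih hb)

theorem Up.exists_of_append {v t : Letter} {α : List Edge} {e : Edge} (h : Up v (α ++ [e]) t) :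
    Up v α (bot e) ∧ Tup e.1 ∧ t = e.1 := by
  induction α generalizing v with
  | nil =>
    cases h with
    | cons _ he hb h => cases h; subst hb; exact ⟨Up.nil _, he, rfl⟩
  | cons f α ih =>
    cases h with
    | cons _ hf hb h =>
      obtain ⟨h1, h2⟩ := ih h
      exact ⟨Up.cons f hf hb h1, h2⟩

theorem PU_append {v t : Letter} {α : List Edge} (h : Up v α t) (e : Edge) :
    PU v (α ++ [e]) = PU v α * an (lab e) * lt e.1 := by
  induction h with
  | nil => rfl
  | cons f hf hb h ih => simp only [List.cons_append, PU, ih, mul_assoc]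

theorem PD_mul_lt {v : Letter} (hv : Vert v) (α : List Edge) : PD v α * lt v = PD v α := by
  cases α with
  | nil => exact hv.mul_self
  | cons e α => simp only [PD, mul_assoc, hv.mul_self]

theorem Up.PU_mul_lt {v t : Letter} {α : List Edge} (h : Up v α t) (hv : Vert v) :
    PU v α * lt t = PU v α := by
  induction h with
  | nil => exact hv.mul_self
  | cons e he hb h ih => rw [PU, mul_assoc, ih he.vert]

theorem Up.lt_mul_PD {v t : Letter} {β : List Edge} (h : Up v β t) (hv : Vert v) :
    lt t * PD v β = PD v β := by
  induction h with
  | nil => exact hv.mul_self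
  | cons e he hb h ih => rw [PD, ← mul_assoc, ← mul_assoc, ih he.vert]

/-- The class of a mountain from `1` to `v`. -/
noncomputable def mt (v : Letter) (α β : List Edge) : F11 := PU (anchor .one) α * PD v β

/-- The classes of mountains from `1` to `v`. -/
def St (v : Letter) (a : F11) : Prop :=
  ∃ α β t, Up (anchor .one) α t ∧ Up v β t ∧ a = mt v α β

theorem vert_one : Vert (anchor .one) := Or.inl rfl

theorem St.mul_lt {v : Letter} {a : F11} (h : St v a) (hv : Vert v) : a * lt v = a := by
  obtain ⟨α, β, t, h1, h2, rfl⟩ := h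
  rw [mt, mul_assoc, PD_mul_lt hv]

theorem St.descend {e : Edge} {a : F11} (he : Tup e.1) (h : St e.1 a) :
    St (bot e) (a * an (lab e).inv * lt (bot e)) := by
  obtain ⟨α, β, t, h1, h2, rfl⟩ := h
  refine ⟨α, e :: β, t, h1, Up.cons e he rfl h2, ?_⟩
  simp only [mt, PD, mul_assoc]

/-- The mirror image of `push`, on classes of words: an ascent moves left through a descent, turning
valleys into peaks, until it cancels or emerges at the summit `t` as an edge `f`. -/
theorem PD_climb {v t : Letter} {β : List Edge} (h : Up v β t) :
    ∀ {e : Edge}, Tup e.1 → bot e = v →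
      (∃ β', Up e.1 β' t ∧ PD v β * an (lab e) * lt e.1 = PD e.1 β') ∨
      ∃ f β', bot f = t ∧ Tup f.1 ∧ Up e.1 β' f.1 ∧
        PD v β * an (lab e) * lt e.1 = lt t * an (lab f) * PD e.1 β' := by
  induction h with
  | nil v =>
    intro e he hb
    exact Or.inr ⟨e, [], hb, he, Up.nil _, rfl⟩
  | @cons b v β t hbT hbv h ih =>
    subst hbv
    intro e he hb
    by_cases hbe : b = e
    · subst hbe
      refine Or.inl ⟨β, h, ?_⟩
      calc _ = PD b.1 β * lt b.1 * an (lab b).inv * lt (bot b) * an (lab b) * lt b.1 := by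
            rw [PD, PD_mul_lt hbT.vert]
        _ = PD b.1 β * (lt b.1 * an (lab b).inv * lt (bot b) * an (lab b) * lt b.1) := by
            simp only [mul_assoc]
        _ = _ := by rw [valley_self hbT, PD_mul_lt hbT.vert]
    · have hk : Tup (sand b e) := Tup.step b e hbT he hbe hb.symm
      have key : PD (bot b) (b :: β) * an (lab e) * lt e.1 =
          PD b.1 β * an (lab (sand b e, true)) * lt (sand b e) *
            an (lab (sand b e, false)).inv * lt e.1 := by
        calc _ = PD b.1 β * lt b.1 * an (lab b).inv * lt (bot e) * an (lab e) * lt e.1 := by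
              rw [PD, PD_mul_lt hbT.vert, hb]
          _ = PD b.1 β * (lt b.1 * an (lab b).inv * lt (bot e) * an (lab e) * lt e.1) := by
              simp only [mul_assoc]
          _ = PD b.1 β * lt b.1 * an (lab b).inv * lt (sand b e) * an (lab e) * lt e.1 := by
              rw [← sandwich_mid hbT he hbe hb.symm]; simp only [mul_assoc]
          _ = _ := by
              rw [PD_mul_lt hbT.vert, lab_sand_false, lab_sand_true, anchor_inv_inv]
      rw [key]
      rcases ih (e := (sand b e, true)) hk rfl with ⟨β', h1, h2⟩ | ⟨f, β', h0, hf, h1, h2⟩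
      · exact Or.inl ⟨(sand b e, false) :: β', Up.cons (sand b e, false) hk rfl h1, by rw [h2]; rfl⟩
      · refine Or.inr ⟨f, (sand b e, false) :: β', h0, hf, Up.cons (sand b e, false) hk rfl h1, ?_⟩
        rw [h2]
        simp only [PD, mul_assoc]

theorem St.climb {e : Edge} {a : F11} (he : Tup e.1) (h : St (bot e) a) :
    St e.1 (a * an (lab e) * lt e.1) := by
  obtain ⟨α, β, t, h1, h2, rfl⟩ := h
  rcases PD_climb h2 he rfl with ⟨β', h3, h4⟩ | ⟨f, β', h0, hf, h3, h4⟩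
  · exact ⟨α, β', t, h1, h3, by rw [mt, mt, ← h4]; simp only [mul_assoc]⟩
  · refine ⟨α ++ [f], β', f.1, h1.append hf h0, h3, ?_⟩
    calc _ = PU (anchor .one) α * (PD (bot e) β * an (lab e) * lt e.1) := by
          simp only [mt, mul_assoc]
      _ = PU (anchor .one) α * lt t * an (lab f) * PD e.1 β' := by
          rw [h4]; simp only [mul_assoc]
      _ = PU (anchor .one) α * an (lab f) * (lt f.1 * PD e.1 β') := by
          rw [h1.PU_mul_lt vert_one, h3.lt_mul_PD he.vert]
      _ = _ := by rw [mt, PU_append h1]; simp only [mul_assoc]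

/-- The relation for `g^L` lets multiplication by `g` be read as a climb over `f` and then the left
edge. The relation for `g^R` lets an element ending at `g` be continued down to `1` without changing
its value. -/
theorem Tup.St_iff {g : Letter} (hg : Tup g) :
    (∀ a, St (anchor .one) a → St g (a * lt g)) ∧ (∀ a, St g a → St (anchor .one) a) ∧
    ∀ b, (∀ a, St (anchor .one) a → St (bot (g, b)) (a * lt (bot (g, b)))) ∧
      (∀ a, St (bot (g, b)) a → St (anchor .one) a) := by
  induction hg with
  | base =>
    refine ⟨fun a h => ?_, fun a h => ?_, fun b => ?_⟩
    · have := St.climb (e := (gxx, false)) Tup.base h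
      change St gxx (a * 1 * lt gxx) at this
      rwa [mul_one] at this
    · have := St.descend (e := (gxx, false)) Tup.base h
      change St (anchor .one) (a * 1 * lt (anchor .one)) at this
      rwa [lt_one, mul_one, mul_one] at this
    · have : bot (gxx, b) = anchor .one := by cases b <;> rfl
      rw [this]
      exact ⟨fun a h => by rwa [h.mul_lt vert_one], fun a h => h⟩
  | step e f he hf hne hb ihe ihf =>
    have hk := Tup.step e f he hf hne hb
    refine ⟨fun a h => ?_, fun a h => ?_, fun b => ?_⟩
    · have h1 : St (bot f) (a * lt (bot f)) := (ihf.2.2 f.2).1 a h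
      have h2 := (h1.climb hf).climb (e := (sand e f, false)) hk
      rw [lab_sand_false] at h2
      rw [← sandwich_left he hf hne hb]
      simpa only [mul_assoc] using h2
    · have h1 := (h.descend (e := (sand e f, true)) hk).descend he
      have h2 := (ihe.2.2 e.2).2 _ h1
      rw [lab_sand_true, anchor_inv_inv, bot_sand_true] at h2
      have h3 : a * an (lab e) * lt e.1 * an (lab e).inv * lt (bot e) = a := by
        calc _ = a * lt (sand e f) * an (lab e) * lt e.1 * an (lab e).inv * lt (bot f) := by
              rw [h.mul_lt hk.vert, hb]
          _ = a * (lt (sand e f) * (an (lab e) * lt e.1 * an (lab e).inv) * lt (bot f)) := by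
              simp only [mul_assoc]
          _ = a := by rw [sandwich_right he hf hne hb, h.mul_lt hk.vert]
      rwa [h3] at h2
    · cases b
      exacts [⟨ihf.1, ihf.2.1⟩, ⟨ihe.1, ihe.2.1⟩]

theorem St.mul_letter {a : F11} (h : St (anchor .one) a) (y : Gen) :
    St (anchor .one) (a * cls (letter y)) := by
  obtain ⟨y, hy⟩ := y
  rcases hy with ⟨c, rfl⟩ | hy
  · change St _ (a * an c)
    have climb : ∀ b, St gxx (a * an (lab (gxx, b)) * lt gxx) := fun b =>
      St.climb (e := (gxx, b)) Tup.base (by cases b <;> exact h)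
    cases c with
    | one => rwa [an_one, mul_one]
    | x =>
      -- Climbing left and descending right over `gxx` multiplies by `x x' x = x`; the opposite
      -- passage gives `x'`.
      have := (climb false).descend (e := (gxx, true)) Tup.base
      change St (anchor .one) (a * 1 * lt gxx * an .x * lt (anchor .one)) at this
      rwa [lt_one, mul_one, mul_one, lt_gxx, mul_assoc, x_mul_xInv_mul_x] at this
    | xInv =>
      have := (climb true).descend (e := (gxx, false)) Tup.base
      change St (anchor .one) (a * an .xInv * lt gxx * 1 * lt (anchor .one)) at this
      rwa [lt_one, mul_one, mul_one, lt_gxx, mul_assoc, ← mul_assoc (an .xInv),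
        xInv_mul_x_mul_xInv] at this
  · have hT := tup_of_mem_G5 hy
    rw [← lt_gen]
    exact hT.St_iff.2.1 _ (hT.St_iff.1 a h)

/-- Every element of `F_1^1` is the class of a mountain. -/
theorem exists_mt (a : F11) : ∃ α β t, Up (anchor .one) α t ∧ Up (anchor .one) β t ∧
    a = mt (anchor .one) α β := by
  have h1 : St (anchor .one) 1 :=
    ⟨[], [], _, Up.nil _, Up.nil _, by simp [mt, PU, PD]⟩
  obtain ⟨u, rfl⟩ := Quotient.exists_rep a
  have : ∀ a, St (anchor .one) a → St (anchor .one) (a * cls u) := by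
    induction u using FreeSemigroup.recOnMul with
    | ih1 y => exact fun a h => h.mul_letter y
    | ih2 y v ih1 ih2 =>
      intro a h
      rw [cls_mul, ← mul_assoc]
      exact ih2 _ (ih1 a h)
  have := this 1 h1
  rw [one_mul] at this
  exact this

/-! ### Normal forms -/

/-- The action of an ascending path. -/
def UU : List Edge → Act
  | [] => 1
  | e :: α => actU e * UU α

/-- The action of an ascending path, when it is descended. -/
noncomputable def DD : List Edge → Act
  | [] => 1
  | e :: β => DD β * actD e

theorem UU_append (α β : List Edge) : UU (α ++ β) = UU α * UU β := by
  induction α with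
  | nil => rfl
  | cons e α ih => rw [List.cons_append, UU, UU, ih, mul_assoc]

theorem DD_append (α β : List Edge) : DD (α ++ β) = DD β * DD α := by
  induction α with
  | nil => rfl
  | cons e α ih => rw [List.cons_append, DD, DD, ih, mul_assoc]

theorem UU_singleton (e : Edge) : UU [e] = actU e := rfl
theorem DD_singleton (e : Edge) : DD [e] = actD e := rfl

theorem DD_mul_UU (α : List Edge) : DD α * UU α = 1 := by
  induction α with
  | nil => rfl
  | cons e α ih =>
    rw [DD, UU, mul_assoc, ← mul_assoc (actD e), actD_mul_actU_self, one_mul, ih]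

theorem UU_apply (α us ds : List Edge) : UU α (us, ds) = (α ++ us, ds) := by
  induction α with
  | nil => rfl
  | cons e α ih =>
    change actU e (UU α (us, ds)) = _
    rw [ih]
    rfl

theorem DD_apply_nil (β ds : List Edge) : DD β ([], ds) = ([], β.reverse ++ ds) := by
  induction β generalizing ds with
  | nil => rfl
  | cons e β ih =>
    change DD β ([], e :: ds) = _
    rw [ih]
    simp

theorem actF_lt {v : Letter} (hv : Vert v) : actF (lt v) = up v * dn v := by
  rw [← hv.actL]
  exact congrArg actF (lt_gen ⟨v, hv.isGenerator⟩)

@[simp] theorem actF_an (a : Anchor) : actF (an a) = actA a := rfl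

theorem Up.actF_PU {v t : Letter} {α : List Edge} (h : Up v α t) (hv : Vert v) :
    actF (PU v α) = up v * UU α * dn t := by
  induction h with
  | nil => exact actF_lt hv
  | cons e he hb h ih =>
    subst hb
    rw [PU, map_mul, map_mul, actF_lt hv, actF_an, ih he.vert, UU, ← dn_lab_up he]
    simp only [mul_assoc]

theorem Up.actF_PD {v t : Letter} {β : List Edge} (h : Up v β t) (hv : Vert v) :
    actF (PD v β) = up t * DD β * dn v := by
  induction h with
  | nil => exact actF_lt hv
  | cons e he hb h ih =>
    subst hb
    rw [PD, map_mul, map_mul, actF_lt hv, actF_an, ih he.vert, DD, ← dn_lab_inv_up he]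
    simp only [mul_assoc]

/-- The class of a mountain from `1` to `1`. -/
noncomputable def mt1 (α β : List Edge) : F11 := PU (anchor .one) α * PD (anchor .one) β

theorem exists_mt1 (a : F11) : ∃ α β t, Up (anchor .one) α t ∧ Up (anchor .one) β t ∧
    a = mt1 α β := exists_mt a

theorem actF_mt1 {t : Letter} {α β : List Edge} (hα : Up (anchor .one) α t)
    (hβ : Up (anchor .one) β t) : actF (mt1 α β) = UU α * DD β := by
  rw [mt1, map_mul, hα.actF_PU vert_one, hβ.actF_PD vert_one]
  change 1 * UU α * dn t * (up t * DD β * 1) = _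
  rw [one_mul, mul_one, mul_assoc, ← mul_assoc (dn t), (hα.vert vert_one).dn_mul_up, one_mul]

/-- The mountain with paths `α`, `β` sends the empty pair to `(α, β.reverse)`, so its action
determines both paths. -/
theorem actF_injective : Function.Injective actF := by
  intro a b h
  obtain ⟨α, β, t, hα, hβ, rfl⟩ := exists_mt1 a
  obtain ⟨γ, δ, r, hγ, hδ, rfl⟩ := exists_mt1 b
  rw [actF_mt1 hα hβ, actF_mt1 hγ hδ] at h
  have h1 := congrFun h ([], [])
  change UU α (DD β _) = UU γ (DD δ _) at h1
  simp only [DD_apply_nil, UU_apply, List.append_nil, Prod.mk.injEq, List.reverse_inj] at h1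
  rw [h1.1, h1.2]

theorem mt1_nil : mt1 [] [] = 1 := by simp [mt1, PU, PD]

theorem Up.eq_nil_of_ht {α : List Edge} {v : Letter} (h : Up v α v) : α = [] := by
  have := h.length
  exact List.length_eq_zero_iff.1 (by omega)

theorem mt1_eq_one {t : Letter} {α β : List Edge} (hα : Up (anchor .one) α t)
    (hβ : Up (anchor .one) β t) : mt1 α β = 1 ↔ α = [] := by
  constructor
  · intro h
    have h1 := congrArg actF h
    rw [actF_mt1 hα hβ, ← mt1_nil, actF_mt1 (Up.nil _) (Up.nil _)] at h1
    have h2 := congrFun h1 ([], [])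
    change UU α (DD β _) = ([], []) at h2
    simp only [DD_apply_nil, UU_apply, List.append_nil, Prod.mk.injEq] at h2
    exact h2.1
  · rintro rfl
    cases hα
    rw [hβ.eq_nil_of_ht, mt1_nil]

theorem mt1_mul_mt1_mul_mt1 {t : Letter} {α β : List Edge} (hα : Up (anchor .one) α t)
    (hβ : Up (anchor .one) β t) : mt1 α β * mt1 β α * mt1 α β = mt1 α β := by
  apply actF_injective
  simp only [map_mul, actF_mt1 hα hβ, actF_mt1 hβ hα]
  calc _ = UU α * (DD β * UU β) * (DD α * UU α) * DD β := by simp only [mul_assoc]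
    _ = _ := by rw [DD_mul_UU, DD_mul_UU, mul_one, mul_one]

theorem mem_F1_iff {a : F11} : a ∈ F1 ↔ a ≠ 1 := Iff.rfl

theorem isRegularSemigroup_F1 : IsRegularSemigroup F1 := by
  rintro ⟨a, ha⟩
  obtain ⟨α, β, t, hα, hβ, rfl⟩ := exists_mt1 a
  have hne : α ≠ [] := fun h => mem_F1_iff.1 ha ((mt1_eq_one hα hβ).2 h)
  refine ⟨⟨mt1 β α, fun h => hne ?_⟩, Subtype.ext (mt1_mul_mt1_mul_mt1 hα hβ)⟩
  have hb := (mt1_eq_one hβ hα).1 h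
  subst hb
  cases hβ
  exact hα.eq_nil_of_ht

/-! ### Absorption -/

/-- Climbing back the second path and then climbing the first one does nothing. -/
def Absorbs : List Edge → List Edge → Prop
  | us, [] => us = []
  | us, d :: δ => ∃ us', push us d = (us', none) ∧ Absorbs us' δ

theorem push_length (us : List Edge) (e : Edge) :
    (push us e).1.length + 1 = us.length + (push us e).2.toList.length := by
  induction us generalizing e with
  | nil => rfl
  | cons f us ih =>
    by_cases h : e = f
    · subst h
      rw [push_cons_self]
      rfl
    · have := ih (sand e f, false)
      rw [push_cons_of_ne h]
      simp only [List.length_cons]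
      omega

theorem actD_mul_UU_of_push {us us' : List Edge} {e : Edge} (h : push us e = (us', none)) :
    actD e * UU us = UU us' := by
  induction us generalizing e us' with
  | nil => simp [push] at h
  | cons f us ih =>
    by_cases hef : e = f
    · subst hef
      rw [push_cons_self, Prod.mk.injEq] at h
      rw [UU, ← mul_assoc, actD_mul_actU_self, one_mul, h.1]
    · rw [push_cons_of_ne hef, Prod.mk.injEq] at h
      obtain ⟨rfl, h⟩ := h
      rw [UU, ← mul_assoc, actD_mul_actU_of_ne hef, mul_assoc, ih (Prod.ext rfl h), UU]

theorem Absorbs.DD_mul_UU {us δ : List Edge} (h : Absorbs us δ) : DD δ * UU us = 1 := by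
  induction δ generalizing us with
  | nil => rw [show us = [] from h]; rfl
  | cons d δ ih =>
    obtain ⟨us', h1, h2⟩ := h
    rw [DD, mul_assoc, actD_mul_UU_of_push h1, ih h2]

theorem Absorbs.length {us δ : List Edge} (h : Absorbs us δ) : us.length = δ.length := by
  induction δ generalizing us with
  | nil => rw [show us = [] from h]
  | cons d δ ih =>
    obtain ⟨us', h1, h2⟩ := h
    have := push_length us d
    rw [h1] at this
    simp only [Option.toList_none, List.length_nil] at this
    rw [List.length_cons, ← ih h2]
    omega

/-- Each descent either cancels one ascending edge or passes through, preserving the length of the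
ascent and adding one edge to the descending path. -/
theorem DD_apply_length (δ us ds : List Edge) :
    (DD δ (us, ds)).1.length + δ.length + ds.length =
      us.length + (DD δ (us, ds)).2.length ∧ ds.length ≤ (DD δ (us, ds)).2.length := by
  induction δ generalizing us ds with
  | nil => exact ⟨rfl, le_rfl⟩
  | cons d δ ih =>
    have h1 := push_length us d
    have h2 := ih (push us d).1 ((push us d).2.toList ++ ds)
    rw [List.length_append] at h2
    change (DD δ ((push us d).1, (push us d).2.toList ++ ds)).1.length + (δ.length + 1) + _ =
      _ + (DD δ ((push us d).1, (push us d).2.toList ++ ds)).2.length ∧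
      _ ≤ (DD δ ((push us d).1, (push us d).2.toList ++ ds)).2.length
    omega

/-- The descending path never shrinks, so if its length is unchanged, every descent must have
cancelled. -/
theorem absorbs_of_DD_apply {δ us ds : List Edge} (h1 : (DD δ (us, ds)).1 = [])
    (h2 : (DD δ (us, ds)).2.length = ds.length) : Absorbs us δ := by
  induction δ generalizing us ds with
  | nil => exact h1
  | cons d δ ih =>
    have h := DD_apply_length δ (push us d).1 ((push us d).2.toList ++ ds)
    change (DD δ ((push us d).1, (push us d).2.toList ++ ds)).1 = [] at h1
    change (DD δ ((push us d).1, (push us d).2.toList ++ ds)).2.length = _ at h2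
    have hn : (push us d).2 = none := by
      rw [h2, List.length_append] at h
      have : (push us d).2.toList.length = 0 := by omega
      rwa [List.length_eq_zero_iff, Option.toList_eq_nil_iff] at this
    refine ⟨(push us d).1, Prod.ext rfl hn, ?_⟩
    rw [hn] at h1 h2
    exact ih h1 h2

theorem push_append (us : List Edge) (u e : Edge) :
    push (us ++ [u]) e =
      match push us e with
      | (us', none) => (us' ++ [u], none)
      | (us', some f) => (us' ++ (push [u] f).1, (push [u] f).2) := by
  induction us generalizing e with
  | nil => rfl
  | cons g us ih =>
    rw [List.cons_append]
    by_cases h : e = g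
    · subst h
      rw [push_cons_self, push_cons_self]
    · rw [push_cons_of_ne h, push_cons_of_ne h, ih]
      rcases push us (sand e g, false) with ⟨us', _ | f⟩ <;> rfl

theorem Absorbs.eq_of_singleton {u d : Edge} (h : Absorbs [u] [d]) : u = d := by
  obtain ⟨us', h, -⟩ := h
  by_contra hne
  rw [push_cons_of_ne (Ne.symm hne)] at h
  cases (Prod.mk.inj h).2

/-- An edge which emerges from a nonempty path is a left one, and leaves a right one on top. -/
theorem push_eq_some {us us' : List Edge} {u e f : Edge} (h : push (us ++ [u]) e = (us', some f)) :
    f.2 = false ∧ ∃ us'' k, us' = us'' ++ [(k, true)] := by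
  induction us generalizing e us' with
  | nil =>
    rw [List.nil_append] at h
    by_cases heu : e = u
    · subst heu
      rw [push_cons_self] at h
      cases (Prod.mk.inj h).2
    · rw [push_cons_of_ne heu] at h
      obtain ⟨rfl, h⟩ := Prod.mk.inj h
      cases h
      exact ⟨rfl, [], _, rfl⟩
  | cons g us ih =>
    rw [List.cons_append] at h
    by_cases heg : e = g
    · subst heg
      rw [push_cons_self] at h
      cases (Prod.mk.inj h).2
    · rw [push_cons_of_ne heg] at h
      obtain ⟨h3, h4⟩ := Prod.mk.inj h
      obtain ⟨h1, us'', k, h2⟩ := ih (e := (sand e g, false)) (Prod.ext rfl h4)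
      exact ⟨h1, (sand e g, true) :: us'', k, h3 ▸ congrArg _ h2⟩

/-- If the top edge `u` survives until `d` arrives, then `u = d`. Otherwise an earlier descent
emerged below `u` and cancelled it: then `u` is a left edge by `push_eq_some`, and a right edge is
now on top. By induction that right edge must equal `d`. -/
theorem Absorbs.of_append {us δ : List Edge} {u d : Edge} (h : Absorbs (us ++ [u]) (δ ++ [d])) :
    u = d ∧ Absorbs us δ ∨ u.2 = false ∧ d.2 = true := by
  induction δ generalizing us u with
  | nil =>
    have hl := h.length
    have hus : us = [] := List.length_eq_zero_iff.1 (by simpa using hl)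
    subst hus
    exact Or.inl ⟨h.eq_of_singleton, rfl⟩
  | cons f δ ih =>
    have hl := h.length
    obtain ⟨vs, h1, h2⟩ := h
    rw [push_append] at h1
    rcases hp : push us f with ⟨us', _ | e⟩
    · rw [hp] at h1
      obtain ⟨rfl, -⟩ := Prod.mk.inj h1
      exact (ih h2).imp (fun h => ⟨h.1, us', hp, h.2⟩) id
    · rw [hp] at h1
      by_cases heu : e = u
      · subst heu
        rcases List.eq_nil_or_concat us with rfl | ⟨us₀, w, rfl⟩
        · simp at hl
        · rw [List.concat_eq_append] at hp
          obtain ⟨h3, us'', k, rfl⟩ := push_eq_some hp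
          simp only [push_cons_self, List.append_nil, Prod.mk.injEq, and_true] at h1
          subst h1
          rcases ih h2 with ⟨h4, -⟩ | ⟨h4, -⟩
          · exact Or.inr ⟨h3, by rw [← h4]⟩
          · cases h4
      · simp only [push_cons_of_ne heu] at h1
        cases (Prod.mk.inj h1).2

/-! ### Inverses -/

/-- Evaluating at the empty pair squeezes the length of the descending path, which cannot decrease,
between equal bounds. The two equations then bound the summit heights in both directions, so nothing
of `α` survives the descent `δ`. -/
theorem absorbs_of_inverse {t r : Letter} {α β γ δ : List Edge} (hα : Up (anchor .one) α t)
    (hβ : Up (anchor .one) β t) (hγ : Up (anchor .one) γ r) (hδ : Up (anchor .one) δ r)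
    (h1 : mt1 α β * mt1 γ δ * mt1 α β = mt1 α β) (h2 : mt1 γ δ * mt1 α β * mt1 γ δ = mt1 γ δ) :
    Absorbs α δ ∧ Absorbs γ β := by
  have key : ∀ {t r : Letter} {α β γ δ : List Edge}, Up (anchor .one) α t →
      Up (anchor .one) β t → Up (anchor .one) γ r → Up (anchor .one) δ r →
      mt1 α β * mt1 γ δ * mt1 α β = mt1 α β →
      (DD δ (α, β.reverse)).2.length = β.length ∧
        (DD β (γ ++ (DD δ (α, β.reverse)).1, (DD δ (α, β.reverse)).2)) = ([], β.reverse) := by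
    intro t r α β γ δ hα hβ hγ hδ h
    have h1 := congrArg actF h
    simp only [map_mul, actF_mt1 hα hβ, actF_mt1 hγ hδ] at h1
    have h2 := congrFun h1 ([], [])
    change UU α (DD β (UU γ (DD δ (UU α (DD β ([], [])))))) = UU α (DD β ([], [])) at h2
    simp only [DD_apply_nil, UU_apply, List.append_nil] at h2
    have h3 := (DD_apply_length δ α β.reverse).2
    generalize DD δ (α, β.reverse) = s at h2 h3 ⊢
    have h4 := (DD_apply_length β (γ ++ s.1) s.2).2
    obtain ⟨us, ds⟩ := s
    rw [UU_apply γ us ds] at h2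
    generalize DD β (γ ++ us, ds) = w at h2 h4 ⊢
    obtain ⟨us', ds'⟩ := w
    rw [UU_apply, Prod.mk.injEq, List.append_right_eq_self] at h2
    obtain ⟨rfl, rfl⟩ := h2
    rw [List.length_reverse] at h3 h4
    exact ⟨le_antisymm h4 h3, rfl⟩
  obtain ⟨h3, h4⟩ := key hα hβ hγ hδ h1
  obtain ⟨h5, -⟩ := key hγ hδ hα hβ h2
  have l1 := DD_apply_length δ α β.reverse
  have l2 := DD_apply_length β γ δ.reverse
  have := hα.length
  have := hβ.length
  have := hγ.length
  have := hδ.length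
  rw [h3, List.length_reverse] at l1
  rw [h5, List.length_reverse] at l2
  have h6 : (DD δ (α, β.reverse)).1 = [] := List.length_eq_zero_iff.1 (by omega)
  refine ⟨absorbs_of_DD_apply h6 (by rw [h3, List.length_reverse]), ?_⟩
  rw [h6, List.append_nil] at h4
  exact absorbs_of_DD_apply (congrArg Prod.fst h4) (by rw [h4, h3, List.length_reverse])

theorem Tup.exists_up {g : Letter} (hg : Tup g) :
    (∃ α, Up (anchor .one) α g) ∧ ∀ b, ∃ α, Up (anchor .one) α (bot (g, b)) := by
  induction hg with
  | base =>
    refine ⟨⟨_, Up.cons (gxx, false) Tup.base rfl (Up.nil _)⟩, fun b => ⟨[], ?_⟩⟩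
    cases b <;> exact Up.nil _
  | step e f he hf hne hb ihe ihf =>
    obtain ⟨α, hα⟩ := ihf.1
    refine ⟨⟨_, hα.append (e := (sand e f, false)) (Tup.step e f he hf hne hb) rfl⟩, fun b => ?_⟩
    cases b
    exacts [ihf.1, ihe.1]

theorem exists_up_bot {e : Edge} (he : Tup e.1) : ∃ α, Up (anchor .one) α (bot e) :=
  he.exists_up.2 e.2

/-! ### Weak generation -/

theorem xF1_eq : (xF1 : F11) = mt1 [(gxx, false)] [(gxx, true)] := by
  change an .x = lt (anchor .one) * 1 * lt gxx * (lt gxx * an .x * lt (anchor .one))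
  rw [lt_one, mul_one, mul_one, one_mul, ← mul_assoc, Tup.base.vert.mul_self, lt_gxx,
    x_mul_xInv_mul_x]

/-- Every element of a subset that is a regular semigroup has an inverse there. -/
theorem exists_inverse {S : Type*} [Semigroup S] {T : Subsemigroup S} (hT : IsRegularSemigroup T)
    {s : S} (hs : s ∈ T) : ∃ t ∈ T, s * t * s = s ∧ t * s * t = t := by
  obtain ⟨⟨t, ht⟩, h⟩ := hT ⟨s, hs⟩
  have h : s * t * s = s := congrArg Subtype.val h
  refine ⟨t * s * t, T.mul_mem (T.mul_mem ht hs) ht, ?_, ?_⟩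
  · calc s * (t * s * t) * s = s * t * s * t * s := by simp only [mul_assoc]
      _ = s := by rw [h, h]
  · calc t * s * t * s * (t * s * t) = t * (s * t * s * t * s) * t := by simp only [mul_assoc]
      _ = t * s * t := by rw [h, h]

theorem exists_inverse_mt1 {T : Subsemigroup F11} (hT : IsRegularSemigroup T)
    {t : Letter} {α β : List Edge} (hα : Up (anchor .one) α t) (hβ : Up (anchor .one) β t)
    (h : mt1 α β ∈ T) : ∃ γ δ r, Up (anchor .one) γ r ∧ Up (anchor .one) δ r ∧ mt1 γ δ ∈ T ∧
      Absorbs α δ ∧ Absorbs γ β := by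
  obtain ⟨a, ha, h1, h2⟩ := exists_inverse hT h
  obtain ⟨γ, δ, r, hγ, hδ, rfl⟩ := exists_mt1 a
  exact ⟨γ, δ, r, hγ, hδ, ha, absorbs_of_inverse hα hβ hγ hδ h1 h2⟩

theorem Absorbs.exists_append_left {us δ : List Edge} {d : Edge} (h : Absorbs us (δ ++ [d])) :
    ∃ us₀ u, us = us₀ ++ [u] := by
  rcases List.eq_nil_or_concat us with rfl | ⟨us₀, u, rfl⟩
  · simpa using h.length
  · exact ⟨us₀, u, by simp⟩

theorem Absorbs.exists_append_right {us δ : List Edge} {u : Edge} (h : Absorbs (us ++ [u]) δ) :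
    ∃ δ₀ d, δ = δ₀ ++ [d] := by
  rcases List.eq_nil_or_concat δ with rfl | ⟨δ₀, d, rfl⟩
  · simpa using h.length
  · exact ⟨δ₀, d, by simp⟩

/-- If a regular subsemigroup contains all mountains of smaller height, and the mountains with
summit `g` climbing the right edge and descending the left one, it contains all mountains with
summit `g`. -/
theorem mt1_mem_of_right_left {T : Subsemigroup F11} (hT : IsRegularSemigroup T) {g : Letter}
    (hg : Tup g)
    (hlow : ∀ b α β, Up (anchor .one) α (bot (g, b)) → Up (anchor .one) β (bot (g, b)) →
      mt1 α β ∈ T)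
    (hRL : ∀ α β, Up (anchor .one) α (bot (g, true)) → Up (anchor .one) β (bot (g, false)) →
      mt1 (α ++ [(g, true)]) (β ++ [(g, false)]) ∈ T)
    {α β : List Edge} {b b' : Bool} (hα : Up (anchor .one) α (bot (g, b)))
    (hβ : Up (anchor .one) β (bot (g, b'))) :
    mt1 (α ++ [(g, b)]) (β ++ [(g, b')]) ∈ T := by
  have hup : ∀ {b α}, Up (anchor .one) α (bot (g, b)) →
      Up (anchor .one) (α ++ [(g, b)]) g := fun {b α} h => h.append (e := (g, b)) hg rfl
  have hLR : ∀ α β, Up (anchor .one) α (bot (g, true)) → Up (anchor .one) β (bot (g, false)) →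
      mt1 (β ++ [(g, false)]) (α ++ [(g, true)]) ∈ T := by
    intro α β hα hβ
    obtain ⟨γ, δ, r, hγ, hδ, hmem, h1, h2⟩ := exists_inverse_mt1 hT (hup hα) (hup hβ)
      (hRL α β hα hβ)
    obtain ⟨δ, d, rfl⟩ := h1.exists_append_right
    obtain ⟨γ, c, rfl⟩ := h2.exists_append_left
    -- The exceptional case needs a left edge first and a right edge second; here the first is a
    -- right edge, and in the next line the second is a left edge.
    obtain ⟨rfl, h4⟩ := h1.of_append.resolve_right (by simp)
    obtain ⟨rfl, h5⟩ := h2.of_append.resolve_right (by simp)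
    -- The lower parts `γ` and `δ` of the inverse are unknown, but `β` absorbs `γ` and `δ` absorbs
    -- `α`; these factors replace them by `β` and `α`.
    have h3 := T.mul_mem (T.mul_mem (hlow _ β β hβ hβ) hmem) (hlow _ α α hα hα)
    convert h3 using 1
    apply actF_injective
    simp only [map_mul, actF_mt1 (hup hβ) (hup hα), actF_mt1 hβ hβ, actF_mt1 hγ hδ,
      actF_mt1 hα hα, UU_append, DD_append, UU_singleton, DD_singleton]
    calc _ = UU β * (DD β * UU γ) * actU (g, false) * actD (g, true) * (DD δ * UU α) * DD α := by
          rw [h4.DD_mul_UU, h5.DD_mul_UU]; simp only [mul_assoc, mul_one]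
      _ = _ := by simp only [mul_assoc]
  have hmul : ∀ {α β γ : List Edge} {t : Letter}, Up (anchor .one) α t → Up (anchor .one) β t →
      Up (anchor .one) γ t → mt1 α β ∈ T → mt1 β γ ∈ T → mt1 α γ ∈ T := by
    intro α β γ t hα hβ hγ h1 h2
    convert T.mul_mem h1 h2 using 1
    apply actF_injective
    rw [map_mul, actF_mt1 hα hβ, actF_mt1 hβ hγ, actF_mt1 hα hγ]
    calc _ = UU α * (DD β * UU β) * DD γ := by rw [DD_mul_UU, mul_one]
      _ = _ := by simp only [mul_assoc]
  -- Mountains using the same edge of `g` twice are products of two opposite ones, through an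
  -- auxiliary path over the other edge.
  obtain ⟨ρ, hρ⟩ := exists_up_bot (e := (g, false)) hg
  obtain ⟨σ, hσ⟩ := exists_up_bot (e := (g, true)) hg
  cases b <;> cases b'
  · exact hmul (hup hα) (hup hσ) (hup hβ) (hLR _ _ hσ hα) (hRL _ _ hσ hβ)
  · exact hLR _ _ hβ hα
  · exact hRL _ _ hα hβ
  · exact hmul (hup hα) (hup hρ) (hup hβ) (hRL _ _ hα hρ) (hLR _ _ hβ hρ)

theorem Up.exists_append {g : Letter} (hg : Tup g) {α : List Edge} (h : Up (anchor .one) α g) :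
    ∃ α₀ b, α = α₀ ++ [(g, b)] ∧ Up (anchor .one) α₀ (bot (g, b)) := by
  rcases List.eq_nil_or_concat α with rfl | ⟨α₀, e, rfl⟩
  · cases h
    cases hg
  · rw [List.concat_eq_append] at h ⊢
    obtain ⟨h1, -, rfl⟩ := h.exists_of_append
    exact ⟨α₀, e.2, rfl, h1⟩

theorem mt1_mem {T : Subsemigroup F11} (hT : IsRegularSemigroup T) (h1 : 1 ∈ T)
    (hx : (xF1 : F11) ∈ T) {g : Letter} (hg : Tup g) :
    (∀ α β, Up (anchor .one) α g → Up (anchor .one) β g → mt1 α β ∈ T) ∧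
      ∀ b α β, Up (anchor .one) α (bot (g, b)) → Up (anchor .one) β (bot (g, b)) →
        mt1 α β ∈ T := by
  have key : ∀ {g : Letter}, Tup g →
      (∀ b α β, Up (anchor .one) α (bot (g, b)) → Up (anchor .one) β (bot (g, b)) →
        mt1 α β ∈ T) →
      (∀ α β, Up (anchor .one) α (bot (g, true)) → Up (anchor .one) β (bot (g, false)) →
        mt1 (α ++ [(g, true)]) (β ++ [(g, false)]) ∈ T) →
      ∀ α β, Up (anchor .one) α g → Up (anchor .one) β g → mt1 α β ∈ T := by
    intro g hg hlow hRL α β hα hβ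
    obtain ⟨α, b, rfl, hα'⟩ := hα.exists_append hg
    obtain ⟨β, b', rfl, hβ'⟩ := hβ.exists_append hg
    exact mt1_mem_of_right_left hT hg hlow hRL hα' hβ'
  induction hg with
  | base =>
    have hbot : ∀ b, bot (gxx, b) = anchor .one := fun b => by cases b <;> rfl
    have hlow : ∀ b α β, Up (anchor .one) α (bot (gxx, b)) →
        Up (anchor .one) β (bot (gxx, b)) → mt1 α β ∈ T := by
      intro b α β hα hβ
      rw [hbot] at hα hβ
      rwa [hα.eq_nil_of_ht, hβ.eq_nil_of_ht, mt1_nil]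
    refine ⟨key Tup.base hlow fun α β hα hβ => ?_, hlow⟩
    rw [hbot] at hα hβ
    rw [hα.eq_nil_of_ht, hβ.eq_nil_of_ht]
    have hup : ∀ b, Up (anchor .one) [(gxx, b)] gxx := fun b =>
      Up.cons (gxx, b) Tup.base (hbot b) (Up.nil _)
    rw [xF1_eq] at hx
    obtain ⟨γ, δ, r, -, -, hmem, h2, h3⟩ := exists_inverse_mt1 hT (hup false) (hup true) hx
    obtain ⟨d, rfl⟩ := List.length_eq_one_iff.1 h2.length.symm
    obtain ⟨c, rfl⟩ := List.length_eq_one_iff.1 h3.length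
    rwa [h2.eq_of_singleton, ← h3.eq_of_singleton]
  | step e f he hf hne hb ihe ihf =>
    have hlow : ∀ b α β, Up (anchor .one) α (bot (sand e f, b)) →
        Up (anchor .one) β (bot (sand e f, b)) → mt1 α β ∈ T := by
      intro b
      cases b
      exacts [ihf.1, ihe.1]
    have hg : Tup (sand e f) := Tup.step e f he hf hne hb
    refine ⟨key hg hlow fun α β hα hβ => ?_, hlow⟩
    -- Any path to the common lower end serves: `DD ρ * UU ρ` cancels in the product, leaving the
    -- valley from `e` to `f`, which becomes the peak over `sand e f`.
    obtain ⟨ρ, hρ⟩ := exists_up_bot he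
    have hρe := hρ.append he rfl
    have hρf := hρ.append hf hb.symm
    convert T.mul_mem (ihe.1 _ _ hα hρe) (ihf.1 _ _ hρf hβ) using 1
    apply actF_injective
    have hα' := hα.append (e := (sand e f, true)) hg rfl
    have hβ' := hβ.append (e := (sand e f, false)) hg rfl
    rw [bot_sand_true] at hα
    rw [bot_sand_false] at hβ
    rw [map_mul, actF_mt1 hα' hβ', actF_mt1 hα hρe, actF_mt1 hρf hβ]
    simp only [UU_append, DD_append, UU_singleton, DD_singleton]
    calc _ = UU α * (actU (sand e f, true) * actD (sand e f, false)) * DD β := by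
          simp only [mul_assoc]
      _ = UU α * (actD e * (DD ρ * UU ρ) * actU f) * DD β := by
          rw [DD_mul_UU, mul_one, actD_mul_actU_of_ne hne]
      _ = _ := by simp only [mul_assoc]

/-- A subsemigroup of `F_1` with the identity of `F_1^1` adjoined. -/
def adjoinOne (T : Subsemigroup F1) : Subsemigroup F11 where
  carrier := {a | a = 1 ∨ ∃ s ∈ T, (s : F11) = a}
  mul_mem' := by
    rintro a b (rfl | ⟨s, hs, rfl⟩) (rfl | ⟨t, ht, rfl⟩)
    · exact Or.inl (one_mul 1)
    · exact Or.inr ⟨t, ht, (one_mul _).symm⟩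
    · exact Or.inr ⟨s, hs, (mul_one _).symm⟩
    · exact Or.inr ⟨s * t, T.mul_mem hs ht, rfl⟩

theorem isRegularSemigroup_adjoinOne {T : Subsemigroup F1} (hT : IsRegularSemigroup T) :
    IsRegularSemigroup (adjoinOne T) := by
  rintro ⟨a, rfl | ⟨s, hs, rfl⟩⟩
  · exact ⟨⟨1, Or.inl rfl⟩, Subtype.ext (by simp)⟩
  · obtain ⟨⟨t, ht⟩, h⟩ := hT ⟨s, hs⟩
    exact ⟨⟨t, Or.inr ⟨t, ht, rfl⟩⟩,
      Subtype.ext (congrArg (fun z : T => ((z : F1) : F11)) h)⟩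

/-- The induction in `mt1_mem` starts from the empty mountain, which is `1`; so `1` is adjoined to
`T` and discarded again at the end. -/
theorem isWeaklyGeneratedBy_xF1 : IsWeaklyGeneratedBy F1 {xF1} := by
  intro T hT hx
  rw [Set.singleton_subset_iff] at hx
  refine eq_top_iff.2 ?_
  rintro ⟨a, ha⟩ -
  obtain ⟨α, β, t, hα, hβ, rfl⟩ := exists_mt1 a
  rcases hα.vert vert_one with rfl | ht
  · exact absurd ((mt1_eq_one hα hβ).2 hα.eq_nil_of_ht) ha
  · have := (mt1_mem (isRegularSemigroup_adjoinOne hT) (Or.inl rfl)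
      (Or.inr ⟨xF1, hx, rfl⟩) ht).1 α β hα hβ
    rcases this with h | ⟨s, hs, h⟩
    · exact absurd h ha
    · rwa [show (⟨mt1 α β, ha⟩ : F1) = s from Subtype.ext h.symm]

end FreeRegular

theorem mainTheorem2 :
    IsRegularSemigroup FreeRegular.F1 ∧
      IsWeaklyGeneratedBy FreeRegular.F1 {FreeRegular.xF1} :=
  ⟨FreeRegular.isRegularSemigroup_F1, FreeRegular.isWeaklyGeneratedBy_xF1⟩
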